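/- Conventions. A monoidal triangulated category (M$\Delta$C) is a triangulated category $\mathbf K$ with shift $\Sigma$ and a monoidal structure $(\otimes, 1)$ whose tensor product is exact in each variable. An object $C$ is compact if $\mathbf K(C,-)$ commutes with set-indexed coproducts; $\mathbf K^c$ is the full subcategory of compact objects. An M$\Delta$C $\mathbf K$ is compactly generated if it has set-indexed coproducts, $\otimes$ preserves them in each variable, the isomorphism classes of compact objects form a set, every non-zero object receives a non-zero map from a compact object, tensor products of compact objects are compact, $1$ is compact, and every compact object is rigid (has duals on both sides). A thick right ideal of $\mathbf K^c$ is a full triangulated subcategory of $\mathbf K^c$ that is closed under direct summands and under $-\otimes B$ for all $B\in\mathbf K^c$; $\langle M\rangle_{\mathrm r}$ is the smallest one containing $M\in\mathbf K^c$. A Zariski space is a Noetherian topological space in which every non-empty irreducible closed subset has a unique generic point. A subset of $X$ is specialization closed if it is a union of closed subsets; $\mathcal X_{sp}$ is the set of these. For a thick right ideal $\mathbf I$ of $\mathbf K^c$ and $N\in\mathbf K$, let $L_{\mathbf I}(N)$ denote the object in the distinguished triangle $\Gamma\to N\to L_{\mathbf I}(N)\to\Sigma\Gamma$, unique up to isomorphism,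 such that $\Gamma$ lies in the smallest localizing subcategory of $\mathbf K$ containing $\mathbf I$ and there are no non-zero maps from objects of $\mathbf I$ to $L_{\mathbf I}(N)$. For $M\in \mathbf K^c$ let $M^*$ be the dual of $M$ with maps $1\to M^*\otimes M$ and $M\otimes M^*\to 1$ satisfying the triangle identities, so that $\mathbf K(M\otimes Q,N)\cong\mathbf K(Q,M^*\otimes N)$. Theorem. Let $\mathbf K$ be a compactly generated M$\Delta$C, $X$ a Zariski space, and $\sigma$ an assignment of a subset $\sigma(A)\subseteq X$ to each object $A$ of $\mathbf K$ such that - $\sigma(0)=\varnothing$ and $\sigma(1)=X$; - $\sigma(\bigoplus_{i\in I}A_i)=\bigcup_{i\in I}\sigma(A_i)$ for all set-indexed families of objects $A_i$ of $\mathbf K$; - $\sigma(\Sigma A)=\sigma(A)$ for all $A \in \mathbf K$; - $\sigma(A)\subseteq\sigma(B)\cup\sigma(C)$ for every distinguished triangle $A\to B\to C\to\Sigma A$ in $\mathbf K$; - the restriction of $\sigma$ to $\mathbf K^c$ is a quasi support datum, i.e. in addition $\sigma(A\otimes B)\subseteq\sigma(A)$ for all $A,B\in\mathbf K^c$. For a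 collection $\mathcal S$ of objects put $\Phi_\sigma(\mathcal S)=\bigcup_{A\in\mathcal S}\sigma(A)$, and for $W\subseteq X$ put $\Theta_\sigma(W)=\{M\in\mathbf K^c : \Phi_\sigma(\langle M\rangle_{\mathrm r})\subseteq W\}$. Assume that for all $M,N\in\mathbf K^c$ with $\Phi_\sigma(\langle N\rangle_{\mathrm r})\subseteq\sigma(M)$, writing $\mathbf I'=\langle M\rangle_{\mathrm r}$, if $M^*\otimes L_{\mathbf I'}(N)=0$ then $L_{\mathbf I'}(N)=0$. Then: 1. $\Theta_\sigma(\Phi_\sigma(\langle M\rangle_{\mathrm r}))=\langle M\rangle_{\mathrm r}$ for every $M\in\mathbf K^c$. 2. Suppose moreover that $\Phi_\sigma(\langle C\rangle_{\mathrm r})$ is closed for every $C\in\mathbf K^c$, and that for every closed $W\subseteq X$ there is $M\in\mathbf K^c$ with $\Phi_\sigma(\langle M\rangle_{\mathrm r})=W$ (realization property). Then $\Phi_\sigma$ maps thick right ideals of $\mathbf K^c$ to specialization-closed subsets of $X$, $\Theta_\sigma$ maps specialization-closed subsets of $X$ to thick right ideals of $\mathbf K^c$, and these two maps are mutually inverse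 bijections $$\{\text{thick right ideals of }\mathbf K^c\}\ \rightleftarrows\ \mathcal X_{sp}.$$ -/

import Mathlib

open CategoryTheory CategoryTheory.Limits CategoryTheory.Pretriangulated
open CategoryTheory.MonoidalCategory TopologicalSpace
open scoped ZeroObject

universe w v u

namespace MonoidalTriangulated

section Categories

variable (K : Type u) [Category.{v} K] [HasZeroObject K] [HasShift K ℤ] [Preadditive K]
  [∀ n : ℤ, (shiftFunctor K n).Additive] [Pretriangulated K]

/-- An object `C` is compact if `K(C, -)`, with values in abelian groups, commutes with
set-indexed coproducts. `compactObjects K` is the full subcategory of compact objects. -/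
def compactObjects : ObjectProperty K := fun C =>
  ∀ ι : Type v, PreservesColimitsOfShape (Discrete ι) (preadditiveCoyoneda.obj (Opposite.op C))

/-- A triangulated category is compactly generated if the isomorphism classes of compact
objects form a set and every non-zero object receives a non-zero map from a compact object. -/
structure IsCompactlyGeneratedTriangulated : Prop where
  small : ObjectProperty.EssentiallySmall.{v} (compactObjects K)
  generates : ∀ M : K, ¬ IsZero M → ∃ (C : K) (f : C ⟶ M), compactObjects K C ∧ f ≠ 0

/-- A functor between triangulated categories is exact if it commutes with the shift and
sends distinguished triangles to distinguished triangles, for some choice of the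
commutation isomorphisms. -/
def IsExactFunctor (F : K ⥤ K) : Prop :=
  ∃ _ : F.CommShift ℤ, F.IsTriangulated

/-- A localizing subcategory: a (strictly full) triangulated subcategory that is closed under
set-indexed coproducts. -/
structure IsLocalizing (P : ObjectProperty K) : Prop where
  triangulated : P.IsTriangulated
  iso_closed : P.IsClosedUnderIsomorphisms
  coproducts : ∀ ι : Type v, P.IsClosedUnderColimitsOfShape (Discrete ι)

variable {K}

/-- `Loc S`: the smallest localizing subcategory that contains `S`. -/
def Loc (S : ObjectProperty K) : ObjectProperty K := fun A =>
  ∀ P : ObjectProperty K, IsLocalizing K P → S ≤ P → P A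

/-- `L` is the localization `L_S(N)` of `N` with respect to `S`: there is a distinguished
triangle `Γ ⟶ N ⟶ L ⟶ Γ⟦1⟧` with `Γ` in `Loc S`, and there are no non-zero maps from objects
of `S` to `L`. For `S` a thick subcategory of the compact objects of a compactly generated
category, this determines the triangle up to isomorphism. -/
def IsLocalizationObj (S : ObjectProperty K) (N L : K) : Prop :=
  (∃ (Γ : K) (f : Γ ⟶ N) (g : N ⟶ L) (h : L ⟶ Γ⟦(1 : ℤ)⟧),
    Triangle.mk f g h ∈ distTriang K ∧ Loc S Γ) ∧
  ∀ (C : K) (φ : C ⟶ L), S C → φ = 0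

end Categories

section Ideals

variable (K : Type u) [Category.{v} K] [HasZeroObject K] [HasShift K ℤ] [Preadditive K]
  [∀ n : ℤ, (shiftFunctor K n).Additive] [Pretriangulated K] [MonoidalCategory K]

/-- A monoidal structure on a triangulated category makes it a monoidal triangulated category
if the tensor product is exact in each variable. -/
structure IsMonoidalTriangulated : Prop where
  exact_tensorLeft : ∀ A : K, IsExactFunctor K (tensorLeft A)
  exact_tensorRight : ∀ A : K, IsExactFunctor K (tensorRight A)

/-- Compactly generated monoidal triangulated categories. The maps of an
`ExactPairing C D` are `𝟙_ K ⟶ C ⊗ D` and `D ⊗ C ⟶ 𝟙_ K`; an object is rigid if it has a dual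
on either side. -/
structure IsCompactlyGeneratedMonoidal : Prop extends
    IsMonoidalTriangulated K, IsCompactlyGeneratedTriangulated K where
  coproducts : HasCoproducts.{v} K
  tensorLeft_coproducts : ∀ (A : K) (ι : Type v),
    PreservesColimitsOfShape (Discrete ι) (tensorLeft A)
  tensorRight_coproducts : ∀ (A : K) (ι : Type v),
    PreservesColimitsOfShape (Discrete ι) (tensorRight A)
  compact_tensor : ∀ A B : K, compactObjects K A → compactObjects K B →
    compactObjects K (A ⊗ B)
  compact_unit : compactObjects K (𝟙_ K)
  rigid : ∀ C : K, compactObjects K C →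
    (∃ D : K, Nonempty (ExactPairing C D)) ∧ (∃ D : K, Nonempty (ExactPairing D C))

variable {K}

/-- A thick right ideal of the category of compact objects: a full triangulated subcategory,
closed under direct summands (that is, retracts) and under tensoring on the right with
compact objects. -/
structure IsThickRightIdeal (I : ObjectProperty K) : Prop where
  le_compact : I ≤ compactObjects K
  triangulated : I.IsTriangulated
  retracts : I.IsStableUnderRetracts
  tensor : ∀ A B : K, I A → compactObjects K B → I (A ⊗ B)

/-- For `M` compact, `rightIdeal M` is the smallest thick right ideal of the category of compact
objects that contains `M`. -/
def rightIdeal (M : K) : ObjectProperty K := fun A =>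
  ∀ I : ObjectProperty K, IsThickRightIdeal I → I M → I A

end Ideals

section Support

variable {K : Type u} [Category.{v} K] [HasZeroObject K] [HasShift K ℤ] [Preadditive K]
  [∀ n : ℤ, (shiftFunctor K n).Additive] [Pretriangulated K] [MonoidalCategory K]
  {X : Type w}

/-- The conditions of an extended quasi support datum that do not involve the tensor product of
two objects: behaviour on `0`, on the unit, on set-indexed coproducts, shifts and triangles. -/
structure IsExtendedSupport (σ : K → Set X) : Prop where
  zero : σ 0 = ∅
  unit : σ (𝟙_ K) = Set.univ
  coproduct : ∀ (ι : Type v) (A : ι → K) (c : Cofan A), Nonempty (IsColimit c) →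
    σ c.pt = ⋃ i, σ (A i)
  shift : ∀ A : K, σ (A⟦(1 : ℤ)⟧) = σ A
  triangle : ∀ T ∈ distTriang K, σ T.obj₁ ⊆ σ T.obj₂ ∪ σ T.obj₃

/-- The restriction of `σ` to the full subcategory of compact objects is a quasi support
datum. (The structure of that subcategory is inherited, so all conditions are imposed on compact
objects.) -/
structure IsQuasiSupportOnCompacts (σ : K → Set X) : Prop where
  zero : σ 0 = ∅
  unit : σ (𝟙_ K) = Set.univ
  sum : ∀ A B : K, compactObjects K A → compactObjects K B → σ (A ⊞ B) = σ A ∪ σ B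
  shift : ∀ A : K, compactObjects K A → σ (A⟦(1 : ℤ)⟧) = σ A
  triangle : ∀ T ∈ distTriang K, compactObjects K T.obj₁ → compactObjects K T.obj₂ →
    compactObjects K T.obj₃ → σ T.obj₁ ⊆ σ T.obj₂ ∪ σ T.obj₃
  tensor : ∀ A B : K, compactObjects K A → compactObjects K B → σ (A ⊗ B) ⊆ σ A

/-- `Φ_σ(S)`, the union of the supports of the objects of `S`. -/
def Phi (σ : K → Set X) (S : ObjectProperty K) : Set X := ⋃ (A : K) (_ : S A), σ A

/-- `Θ_σ(W)`, the compact objects `M` with `Φ_σ(⟨M⟩_r) ⊆ W`. -/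
def Theta (σ : K → Set X) (W : Set X) : ObjectProperty K := fun M =>
  compactObjects K M ∧ Phi σ (rightIdeal M) ⊆ W

/-- The realization property: every closed subset is `Φ_σ(⟨M⟩_r)` for some compact `M`. -/
def Realization [TopologicalSpace X] (σ : K → Set X) : Prop :=
  ∀ W : Set X, IsClosed W → ∃ M : K, compactObjects K M ∧ Phi σ (rightIdeal M) = W

/-- The homological assumption: for compact `M`, `N` with `Φ_σ(⟨N⟩_r) ⊆ σ(M)`, if `D ⊗ L = 0`
then `L = 0`, where `L` is the localization of `N` with respect to `⟨M⟩_r`, and `D` is the dual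
of `M` with maps `𝟙_ K ⟶ D ⊗ M` and `M ⊗ D ⟶ 𝟙_ K`, so that `D ⊗ -` is right adjoint to
`M ⊗ -`. (Both `D` and `L` are unique up to isomorphism.) -/
def HomologicalAssumption (σ : K → Set X) : Prop :=
  ∀ M N : K, compactObjects K M → compactObjects K N → Phi σ (rightIdeal N) ⊆ σ M →
    ∀ D L : K, Nonempty (ExactPairing D M) → IsLocalizationObj (rightIdeal M) N L →
      IsZero (D ⊗ L) → IsZero L

end Support

end MonoidalTriangulated

/-!
The two maps are compared through the localization triangle `Γ ⟶ N ⟶ L` of a compact object `N`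
with respect to the right ideal `⟨M⟩` of a compact object `M`.

Because tensoring on the right shrinks supports, the compact objects supported in a given set form
a thick right ideal, so `Φ ⟨M⟩ = σ M` (`Phi_rightIdeal`). It has to be shown that `σ N ⊆ σ M`
implies `N ∈ ⟨M⟩` (`mem_rightIdeal_of_support_subset`). By construction `⟨M⟩` has no non-zero maps
to `L`; by duality, neither does any compact object to `M* ⊗ L`, and `M* ⊗ L = 0` by compact
generation (`isZero_dual_tensor`). The homological assumption then gives `L = 0`, and `N ≅ Γ` is a
compact object of the localizing subcategory generated by `⟨M⟩`. By a theorem of Neeman such an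
object already lies in `⟨M⟩`.

The existence of the triangle and the required case of Neeman's theorem are proved together in
`exists_isLocalizationObj`. The object `Γ` is built as a homotopy colimit of objects `Γ n` over
`N`, each obtained from the previous one by attaching cones on coproducts of objects of the ideal.
A map from a compact object to `Γ` factors through some `Γ n` (`exists_homotopyColimit`), and a map
from a compact object to `Γ n` factors through an object of the ideal
(`CompactMapsFactor.sigma`, `CompactMapsFactor.ext₂`). The latter rests on the octahedral axiom.
When `Γ ≅ N`, the identity of `N` factors in this way, and `N` is a retract of an object of the
ideal. Throughout, compactness of `X` is used in the form that every map from `X` to a coproduct is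
a finite sum of maps factoring through summands.

For an arbitrary thick right ideal `I` and compact `N` with `σ N ⊆ Φ I`, the closed set `σ N` of the
Noetherian space has finitely many irreducible components. Each generic point lies in the closed
support of an object of `I`, so `σ N` is contained in the support of the sum of these objects, which
reduces the claim to the case of a principal ideal. Conversely, the realization property
applied to the closures of points shows that every specialization-closed set is recovered.
-/

namespace MonoidalTriangulated

/-! ### Compact objects and finite sums of maps into coproducts -/

/-- If a group is equipped with maps `φ i` and projections `π i` that behave like those of a
direct sum, every element of the subgroup generated by the images of the `φ i` is the finite sum
of its components. -/
lemma exists_eq_sum_of_mem_closure {ι H : Type*} [AddCommGroup H] {G : ι → Type*}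
    [∀ i, AddCommGroup (G i)] (φ : ∀ i, G i →+ H) (π : ∀ i, H →+ G i)
    (h_id : ∀ i y, π i (φ i y) = y) (h_ne : ∀ i j, i ≠ j → ∀ y, π j (φ i y) = 0) {x : H}
    (hx : x ∈ AddSubgroup.closure {x | ∃ (i : ι) (y : G i), x = φ i y}) :
    ∃ s : Finset ι, x = ∑ i ∈ s, φ i (π i x) := by
  classical
  suffices h : ∃ s : Finset ι, ∀ t, s ⊆ t → x = ∑ i ∈ t, φ i (π i x) by
    obtain ⟨s, hs⟩ := h
    exact ⟨s, hs s subset_rfl⟩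
  induction hx using AddSubgroup.closure_induction with
  | mem x hx =>
    obtain ⟨i, y, rfl⟩ := hx
    refine ⟨{i}, fun t ht => ?_⟩
    rw [Finset.sum_eq_single i]
    · rw [h_id]
    · intro j _ hj
      rw [h_ne i j hj.symm, map_zero]
    · intro hi
      exact absurd (ht (Finset.mem_singleton_self i)) hi
  | zero => exact ⟨∅, fun t _ => by simp⟩
  | add f₁ f₂ _ _ h₁ h₂ =>
    obtain ⟨s₁, h₁⟩ := h₁
    obtain ⟨s₂, h₂⟩ := h₂
    refine ⟨s₁ ∪ s₂, fun t ht => ?_⟩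
    have e₁ := h₁ t (Finset.subset_union_left.trans ht)
    have e₂ := h₂ t (Finset.subset_union_right.trans ht)
    simp only [map_add, Finset.sum_add_distrib, ← e₁, ← e₂]
  | neg f _ h =>
    obtain ⟨s, h⟩ := h
    refine ⟨s, fun t ht => ?_⟩
    have e := h t ht
    simp only [map_neg, Finset.sum_neg_distrib, ← e]

section Preadditive

variable {C : Type u} [Category.{v} C] [Preadditive C]

/-- The maps `X ⟶ ∐ A` that are finite sums of maps factoring through one of the inclusions.
The coproduct is given by a cofan `c`, which is not required to be a colimit. -/
def finiteHoms {ι : Type*} {A : ι → C} (c : Cofan A) (X : C) : AddSubgroup (X ⟶ c.pt) :=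
  AddSubgroup.closure {f | ∃ (i : ι) (y : X ⟶ A i), f = y ≫ c.inj i}

lemma comp_inj_mem_finiteHoms {ι : Type*} {A : ι → C} (c : Cofan A) {X : C} {i : ι}
    (y : X ⟶ A i) : y ≫ c.inj i ∈ finiteHoms c X :=
  AddSubgroup.subset_closure ⟨i, y, rfl⟩

lemma finiteHoms_precomp {ι : Type*} {A : ι → C} (c : Cofan A) {X Y : C} (g : X ⟶ Y)
    {f : Y ⟶ c.pt} (hf : f ∈ finiteHoms c Y) : g ≫ f ∈ finiteHoms c X := by
  induction hf using AddSubgroup.closure_induction with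
  | mem f hf =>
    obtain ⟨i, y, rfl⟩ := hf
    rw [← Category.assoc]
    exact comp_inj_mem_finiteHoms c _
  | zero => rw [comp_zero]; exact zero_mem _
  | add f₁ f₂ _ _ h₁ h₂ => rw [Preadditive.comp_add]; exact add_mem h₁ h₂
  | neg f _ h => rw [Preadditive.comp_neg]; exact neg_mem h

lemma exists_eq_sum_of_mem_finiteHoms {ι : Type*} [DecidableEq ι] {A : ι → C} [HasCoproduct A]
    {X : C} {f : X ⟶ ∐ A} (hf : f ∈ finiteHoms (Cofan.mk _ (Sigma.ι A)) X) :
    ∃ s : Finset ι, f = ∑ i ∈ s, (f ≫ Sigma.π A i) ≫ Sigma.ι A i :=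
  exists_eq_sum_of_mem_closure (fun i => Preadditive.rightComp X (Sigma.ι A i))
    (fun i => Preadditive.rightComp X (Sigma.π A i)) (fun i y => by simp [Preadditive.rightComp])
    (fun i j hij y => by simp [Preadditive.rightComp, Sigma.ι_π_of_ne A hij]) hf

end Preadditive

/-- A coproduct of abelian groups is generated by the images of the inclusions: otherwise the
projection to the quotient by the subgroup they generate would be a non-zero map that vanishes
on every summand. -/
lemma closure_inj_eq_top {ι : Type*} {G : ι → AddCommGrpCat.{v}} {c : Cofan G}
    (hc : IsColimit c) :
    AddSubgroup.closure {x : c.pt | ∃ (i : ι) (y : G i), x = c.inj i y} = ⊤ := by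
  set S := AddSubgroup.closure {x : c.pt | ∃ (i : ι) (y : G i), x = c.inj i y} with hS
  have h : AddCommGrpCat.ofHom (QuotientAddGroup.mk' S) = 0 := by
    refine Cofan.IsColimit.hom_ext hc _ _ fun i => ?_
    ext y
    change QuotientAddGroup.mk' S (c.inj i y) = 0
    exact (QuotientAddGroup.eq_zero_iff _).2 (AddSubgroup.subset_closure ⟨i, y, rfl⟩)
  refine eq_top_iff.2 fun x _ => ?_
  have hx := ConcreteCategory.congr_hom h x
  exact (QuotientAddGroup.eq_zero_iff x).1 hx

section Compact

variable {K : Type u} [Category.{v} K] [Preadditive K]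

lemma mem_finiteHoms_of_preservesCoproducts {X : K} (ι : Type v)
    [PreservesColimitsOfShape (Discrete ι) (preadditiveCoyoneda.obj (Opposite.op X))]
    {A : ι → K} {c : Cofan A} (hc : IsColimit c) (f : X ⟶ c.pt) : f ∈ finiteHoms c X := by
  have h := closure_inj_eq_top (Cofan.isColimitMapCoconeEquiv _ _ c
    (isColimitOfPreserves (preadditiveCoyoneda.obj (Opposite.op X)) hc))
  exact h.ge (AddSubgroup.mem_top f)

/-- In a category with coproducts, `X` is compact as soon as every map from `X` to a
coproduct is a finite sum of maps factoring through the summands; uniqueness of the components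
is automatic. -/
lemma preservesCoproducts_of_mem_finiteHoms [HasCoproducts.{v} K] {X : K}
    (h : ∀ (ι : Type v) (A : ι → K) (f : X ⟶ ∐ A), f ∈ finiteHoms (Cofan.mk _ (Sigma.ι A)) X)
    (ι : Type v) :
    PreservesColimitsOfShape (Discrete ι) (preadditiveCoyoneda.obj (Opposite.op X)) := by
  suffices ∀ A : ι → K, PreservesColimit (Discrete.functor A)
      (preadditiveCoyoneda.obj (Opposite.op X)) from preservesColimitsOfShape_of_discrete _
  intro A
  set F := preadditiveCoyoneda.obj (Opposite.op X)
  suffices hb : Function.Bijective (sigmaComparison F A) by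
    have : IsIso (sigmaComparison F A) :=
      (ConcreteCategory.isIso_iff_bijective _).2 hb
    exact PreservesCoproduct.of_iso_comparison F A
  have hι : ∀ (i : ι) (y : X ⟶ A i),
      sigmaComparison F A (Sigma.ι (fun b => F.obj (A b)) i y) = y ≫ Sigma.ι A i := by
    intro i y
    have := ConcreteCategory.congr_hom (ι_comp_sigmaComparison F A i) y
    exact this
  classical
  refine ⟨(injective_iff_map_eq_zero (sigmaComparison F A).hom).2 fun x hx => ?_, fun f => ?_⟩
  · have hx' := (closure_inj_eq_top
      (coproductIsCoproduct fun b => F.obj (A b))).ge (AddSubgroup.mem_top x)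
    obtain ⟨s, hs⟩ := exists_eq_sum_of_mem_closure
      (fun i => (Sigma.ι (fun b => F.obj (A b)) i).hom)
      (fun i => (Sigma.π (fun b => F.obj (A b)) i).hom)
      (fun i y => ConcreteCategory.congr_hom (Sigma.ι_π_eq_id (fun b => F.obj (A b)) i) y)
      (fun i j hij y =>
        ConcreteCategory.congr_hom (Sigma.ι_π_of_ne (fun b => F.obj (A b)) hij) y) hx'
    rw [hs]
    refine Finset.sum_eq_zero fun i _ => ?_
    -- The projections of the coproduct of groups factor through the comparison map.
    have hπ : sigmaComparison F A ≫ F.map (Sigma.π A i) =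
        Sigma.π (fun b => F.obj (A b)) i := by
      refine Sigma.hom_ext _ _ fun j => ?_
      rw [ι_comp_sigmaComparison_assoc, ← F.map_comp]
      by_cases hij : j = i
      · subst hij
        rw [Sigma.ι_π_eq_id, Sigma.ι_π_eq_id, F.map_id]
      · rw [Sigma.ι_π_of_ne _ hij, Sigma.ι_π_of_ne _ hij, F.map_zero]
    have hπx : (Sigma.π (fun b => F.obj (A b)) i).hom x = 0 := by
      rw [← hπ]
      change F.map (Sigma.π A i) ((sigmaComparison F A).hom x) = 0
      rw [hx, map_zero]
    rw [hπx, map_zero]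
  · have hf : (f : X ⟶ ∐ A) ∈ finiteHoms (Cofan.mk _ (Sigma.ι A)) X :=
      h ι A f
    change f ∈ (sigmaComparison F A).hom.range
    exact (AddSubgroup.closure_le _).2
      (by rintro _ ⟨i, y, rfl⟩; exact ⟨_, hι i y⟩) hf

end Compact

section Preadditive

variable {K : Type u} [Category.{v} K] [Preadditive K]

lemma mem_finiteHoms {X : K} (hX : compactObjects K X) {ι : Type v} {A : ι → K} {c : Cofan A}
    (hc : IsColimit c) (f : X ⟶ c.pt) : f ∈ finiteHoms c X :=
  have := hX ι
  mem_finiteHoms_of_preservesCoproducts ι hc f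

lemma mem_finiteHoms_sigma [HasCoproducts.{v} K] {X : K} (hX : compactObjects K X) {ι : Type v}
    {A : ι → K} (f : X ⟶ ∐ A) : f ∈ finiteHoms (Cofan.mk _ (Sigma.ι A)) X :=
  mem_finiteHoms hX (coproductIsCoproduct A) f

lemma compactObjects.sigma_induction [HasCoproducts.{v} K] {X : K} (hX : compactObjects K X)
    {ι : Type v} {A : ι → K} {motive : (X ⟶ ∐ A) → Prop} (zero : motive 0)
    (add : ∀ f g, motive f → motive g → motive (f + g))
    (inj : ∀ (i : ι) (y : X ⟶ A i), motive (y ≫ Sigma.ι A i)) (f : X ⟶ ∐ A) : motive f := by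
  classical
  obtain ⟨s, hs⟩ := exists_eq_sum_of_mem_finiteHoms (mem_finiteHoms_sigma hX f)
  rw [hs]
  exact Finset.sum_induction _ _ add zero fun i _ => inj i _

lemma compactObjects_of_retract [HasCoproducts.{v} K] {X Y : K} (r : Retract X Y)
    (hY : compactObjects K Y) : compactObjects K X :=
  preservesCoproducts_of_mem_finiteHoms fun ι A f => by
    have h := finiteHoms_precomp _ r.i (mem_finiteHoms_sigma hY (r.r ≫ f))
    rwa [r.retract_assoc] at h

instance [HasCoproducts.{v} K] : (compactObjects K).IsStableUnderRetracts where
  of_retract r h := compactObjects_of_retract r h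

lemma compactObjects_of_isZero [HasCoproducts.{v} K] {X : K} (hX : IsZero X) :
    compactObjects K X :=
  preservesCoproducts_of_mem_finiteHoms fun ι A f => by
    rw [hX.eq_of_src f 0]
    exact zero_mem _

end Preadditive

lemma compactObjects_shift {K : Type u} [Category.{v} K] [HasShift K ℤ] [Preadditive K]
    [∀ n : ℤ, (shiftFunctor K n).Additive] [HasCoproducts.{v} K] {X : K}
    (hX : compactObjects K X) (n : ℤ) :
    compactObjects K (X⟦n⟧) := by
  refine preservesCoproducts_of_mem_finiteHoms fun ι A f => ?_
  let adj := (shiftEquiv K n).toAdjunction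
  have : (shiftEquiv K n).functor.Additive := inferInstanceAs (shiftFunctor K n).Additive
  have hc := Cofan.isColimitMapCoconeEquiv (shiftEquiv K n).inverse _ _
    (isColimitOfPreserves (shiftEquiv K n).inverse (coproductIsCoproduct A))
  obtain ⟨g, rfl⟩ := (adj.homEquiv _ _).symm.surjective f
  have hg := mem_finiteHoms hX hc g
  induction hg using AddSubgroup.closure_induction with
  | mem g hg =>
    obtain ⟨i, y, rfl⟩ := hg
    erw [Adjunction.homEquiv_naturality_right_symm]
    exact comp_inj_mem_finiteHoms _ _
  | zero =>
    rw [show (adj.homEquiv X (∐ A)).symm 0 = 0 from (adj.homAddEquiv X (∐ A)).symm.map_zero]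
    exact zero_mem _
  | add f₁ f₂ _ _ h₁ h₂ =>
    rw [show (adj.homEquiv X (∐ A)).symm (f₁ + f₂) = _ from
      (adj.homAddEquiv X (∐ A)).symm.map_add f₁ f₂]
    exact add_mem h₁ h₂
  | neg f _ h =>
    rw [show (adj.homEquiv X (∐ A)).symm (-f) = _ from
      (adj.homAddEquiv X (∐ A)).symm.map_neg f]
    exact neg_mem h

section Triangulated

variable {K : Type u} [Category.{v} K] [HasZeroObject K] [HasShift K ℤ] [Preadditive K]
  [∀ n : ℤ, (shiftFunctor K n).Additive] [Pretriangulated K]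

/-- Compact objects are closed under extensions. If `f : T.obj₂ ⟶ ∐ A` is restricted to `T.obj₁`,
the result involves finitely many summands only; after subtracting the corresponding components,
`f` factors through `T.obj₃`. -/
lemma compactObjects_ext₂ [HasCoproducts.{v} K] {T : Triangle K} (hT : T ∈ distTriang K)
    (h₁ : compactObjects K T.obj₁) (h₃ : compactObjects K T.obj₃) :
    compactObjects K T.obj₂ := by
  classical
  refine preservesCoproducts_of_mem_finiteHoms fun ι A f => ?_
  obtain ⟨s, hs⟩ := exists_eq_sum_of_mem_finiteHoms (mem_finiteHoms_sigma h₁ (T.mor₁ ≫ f))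
  obtain ⟨k, hk⟩ := Triangle.yoneda_exact₂ T hT (f - ∑ i ∈ s, (f ≫ Sigma.π A i) ≫ Sigma.ι A i) (by
    rw [Preadditive.comp_sub, Preadditive.comp_sum, sub_eq_zero]
    simpa using hs)
  rw [sub_eq_iff_eq_add] at hk
  rw [hk]
  exact add_mem (finiteHoms_precomp _ _ (mem_finiteHoms_sigma h₃ k))
    (sum_mem fun i _ => comp_inj_mem_finiteHoms (Cofan.mk _ (Sigma.ι A)) _)

instance [HasCoproducts.{v} K] : (compactObjects K).IsTriangulated where
  exists_zero := ⟨0, isZero_zero K, compactObjects_of_isZero (isZero_zero K)⟩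
  isStableUnderShiftBy n := ⟨fun _ hX => compactObjects_shift hX n⟩
  ext₂' _ hT h₁ h₃ := ObjectProperty.le_isoClosure _ _ (compactObjects_ext₂ hT h₁ h₃)

end Triangulated

/-! ### Homotopy colimits of sequences -/

lemma exists_comp_eq_map_shift {K : Type u} [Category.{v} K] [HasShift K ℤ] {X Y : K}
    (f : X ⟶ Y⟦(1 : ℤ)⟧) :
    ∃ (e : X⟦(-1 : ℤ)⟧⟦(1 : ℤ)⟧ ≅ X) (g : X⟦(-1 : ℤ)⟧ ⟶ Y), e.hom ≫ f = g⟦1⟧' :=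
  ⟨shiftNegShift X 1, (shiftFunctor K (1 : ℤ)).preimage ((shiftNegShift X 1).hom ≫ f), by simp⟩

/-- If composition with `t` is injective on maps from objects of a class stable under shifts,
so is composition with the shift of `t`. -/
lemma eq_zero_of_comp_shift_eq_zero {K : Type u} [Category.{v} K] [HasShift K ℤ]
    [Preadditive K] [∀ n : ℤ, (shiftFunctor K n).Additive] {P : ObjectProperty K}
    [P.IsStableUnderShift ℤ] {Y Z : K} {t : Y ⟶ Z}
    (ht : ∀ (X : K) (g : X ⟶ Y), P X → g ≫ t = 0 → g = 0) {X : K} (hX : P X)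
    (f : X ⟶ Y⟦(1 : ℤ)⟧) (hf : f ≫ t⟦(1 : ℤ)⟧' = 0) : f = 0 := by
  obtain ⟨e, g, hg⟩ := exists_comp_eq_map_shift f
  have hg0 : g = 0 := by
    refine ht _ g (P.le_shift (-1) _ hX) ((shiftFunctor K (1 : ℤ)).map_injective ?_)
    rw [Functor.map_comp, ← hg, Category.assoc, hf, comp_zero, Functor.map_zero]
  rw [← cancel_epi e.hom, hg, hg0, Functor.map_zero, comp_zero]

section

variable {K : Type u} [Category.{v} K] [HasZeroObject K] [HasShift K ℤ] [Preadditive K]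
  [∀ n : ℤ, (shiftFunctor K n).Additive] [Pretriangulated K]

lemma IsLocalizing.sigma {P : ObjectProperty K} (hP : IsLocalizing K P) [HasCoproducts.{v} K]
    {ι : Type v} {A : ι → K} (hA : ∀ i, P (A i)) : P (∐ A) :=
  have := hP.coproducts ι
  P.prop_colimit _ fun j => hA j.as

lemma IsLocalizing.cone {P : ObjectProperty K} (hP : IsLocalizing K P) {T : Triangle K}
    (hT : T ∈ distTriang K) (h₁ : P T.obj₁) (h₂ : P T.obj₂) : P T.obj₃ :=
  have := hP.triangulated
  have := hP.iso_closed
  P.ext_of_isTriangulatedClosed₃ T hT h₁ h₂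

/-- The homotopy colimit of a sequence `A 0 ⟶ A 1 ⟶ ⋯`, the cone of `1 - s` on `∐ A`, where `s`
is the shift map. It is a weak colimit, maps from compact objects factor through some
`A n`, and it belongs to every localizing subcategory that contains the `A n`. -/
lemma exists_homotopyColimit [HasCoproducts.{v} K] {A : ℕ → K} (s : ∀ n, A n ⟶ A (n + 1)) :
    ∃ (H : K) (a : ∀ n, A n ⟶ H), (∀ n, s n ≫ a (n + 1) = a n) ∧
      (∀ (X : K), compactObjects K X → ∀ f : X ⟶ H, ∃ (n : ℕ) (g : X ⟶ A n), f = g ≫ a n) ∧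
      (∀ (Y : K) (f : ∀ n, A n ⟶ Y), (∀ n, s n ≫ f (n + 1) = f n) →
        ∃ φ : H ⟶ Y, ∀ n, a n ≫ φ = f n) ∧
      ∀ P : ObjectProperty K, IsLocalizing K P → (∀ n, P (A n)) → P H := by
  let B : ULift.{v} ℕ → K := fun i => A i.down
  let d : ∐ B ⟶ ∐ B := Sigma.desc fun i => s i.down ≫ Sigma.ι B ⟨i.down + 1⟩
  have hd : ∀ n, Sigma.ι B ⟨n⟩ ≫ d = s n ≫ Sigma.ι B ⟨n + 1⟩ := fun n => Sigma.ι_desc _ _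
  obtain ⟨H, p, q, hT⟩ := distinguished_cocone_triangle (𝟙 (∐ B) - d)
  have hp : p = d ≫ p := by
    have : (𝟙 _ - d) ≫ p = 0 := comp_distTriang_mor_zero₁₂ _ hT
    rwa [Preadditive.sub_comp, Category.id_comp, sub_eq_zero] at this
  have ha : ∀ n, s n ≫ Sigma.ι B ⟨n + 1⟩ ≫ p = Sigma.ι B ⟨n⟩ ≫ p := fun n => by
    rw [← reassoc_of% hd n, ← hp]
  refine ⟨H, fun n => Sigma.ι B ⟨n⟩ ≫ p, ha, fun X hX f => ?_, fun Y f hf => ?_,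
    fun P hP hA => hP.cone hT (hP.sigma fun i => hA _) (hP.sigma fun i => hA _)⟩
  · -- The components of a map `g` with `g = g ≫ d` vanish one after the other, and a map from a
    -- compact object is determined by its components.
    have hinj : ∀ (X : K) (g : X ⟶ ∐ B), compactObjects K X → g ≫ (𝟙 _ - d) = 0 → g = 0 := by
      intro X g hX hg
      rw [Preadditive.comp_sub, Category.comp_id, sub_eq_zero] at hg
      have hdπ₀ : d ≫ Sigma.π B ⟨0⟩ = 0 := by
        refine Sigma.hom_ext _ _ fun i => ?_
        rw [reassoc_of% hd i.down, Sigma.ι_π_of_ne _ (by simp), comp_zero, comp_zero]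
      have hdπ : ∀ n, d ≫ Sigma.π B ⟨n + 1⟩ = Sigma.π B ⟨n⟩ ≫ s n := by
        intro n
        refine Sigma.hom_ext _ _ fun i => ?_
        rw [reassoc_of% hd i.down]
        by_cases h : i = ⟨n⟩
        · subst h
          rw [Sigma.ι_π_eq_id, Sigma.ι_π_eq_id_assoc]
          exact Category.comp_id _
        · rw [Sigma.ι_π_of_ne_assoc _ h, Sigma.ι_π_of_ne, comp_zero, zero_comp]
          intro h'
          apply h
          ext
          simpa using h'
      have hπ : ∀ n, g ≫ Sigma.π B ⟨n⟩ = 0 := by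
        intro n
        induction n with
        | zero => rw [hg, Category.assoc, hdπ₀, comp_zero]
        | succ n ih => rw [hg, Category.assoc, hdπ, reassoc_of% ih, zero_comp]
      obtain ⟨t, ht⟩ := exists_eq_sum_of_mem_finiteHoms (mem_finiteHoms_sigma hX g)
      rw [ht]
      exact Finset.sum_eq_zero fun i _ => by rw [hπ, zero_comp]
    have hq : f ≫ q = 0 := by
      refine eq_zero_of_comp_shift_eq_zero hinj hX _ ?_
      have : q ≫ (𝟙 _ - d)⟦(1 : ℤ)⟧' = 0 := comp_distTriang_mor_zero₃₁ _ hT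
      rw [Category.assoc, this, comp_zero]
    obtain ⟨g : X ⟶ ∐ B, rfl : f = g ≫ p⟩ := Triangle.coyoneda_exact₃ _ hT f hq
    -- A finite sum of maps factoring through stages factors through the largest of these stages.
    suffices h : ∃ n, ∀ m, n ≤ m → ∃ y : X ⟶ A m, g ≫ p = y ≫ Sigma.ι B ⟨m⟩ ≫ p by
      obtain ⟨n, h⟩ := h
      exact ⟨n, h n le_rfl⟩
    clear hq
    revert g
    refine hX.sigma_induction ?_ ?_ ?_
    · exact ⟨0, fun m _ => ⟨0, zero_comp.trans zero_comp.symm⟩⟩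
    · rintro g₁ g₂ ⟨n₁, h₁⟩ ⟨n₂, h₂⟩
      refine ⟨max n₁ n₂, fun m hm => ?_⟩
      obtain ⟨y₁, e₁⟩ := h₁ m (le_of_max_le_left hm)
      obtain ⟨y₂, e₂⟩ := h₂ m (le_of_max_le_right hm)
      exact ⟨y₁ + y₂, by rw [Preadditive.add_comp, e₁, e₂]; exact (Preadditive.add_comp ..).symm⟩
    · rintro ⟨i⟩ y
      refine ⟨i, fun m hm => ?_⟩
      induction m, hm using Nat.le_induction with
      | base => exact ⟨y, Category.assoc _ _ _⟩
      | succ m _ ih =>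
        obtain ⟨z, hz⟩ := ih
        exact ⟨z ≫ s m, by rw [hz, Category.assoc, ha]⟩
  · have hφ : (𝟙 (∐ B) - d) ≫ Sigma.desc (fun i => f i.down) = 0 := by
      refine Sigma.hom_ext _ _ fun i => ?_
      rw [Preadditive.sub_comp, Preadditive.comp_sub, Category.id_comp, reassoc_of% hd i.down,
        Sigma.ι_desc, Sigma.ι_desc, hf, sub_self, comp_zero]
    obtain ⟨φ : H ⟶ Y, hφ : _ = p ≫ φ⟩ := Triangle.yoneda_exact₂ _ hT _ hφ
    refine ⟨φ, fun n => ?_⟩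
    rw [Category.assoc, ← hφ, Sigma.ι_desc]

end

/-! ### Maps from compact objects that factor through a class of objects -/

section

variable {K : Type u} [Category.{v} K] [HasShift K ℤ] [Preadditive K]
  [∀ n : ℤ, (shiftFunctor K n).Additive]

/-- Every map from a compact object to `A` factors through an object of `I`. -/
def CompactMapsFactor (I : ObjectProperty K) (A : K) : Prop :=
  ∀ (X : K) (f : X ⟶ A), compactObjects K X →
    ∃ (E : K) (g : X ⟶ E) (h : E ⟶ A), I E ∧ f = g ≫ h

lemma CompactMapsFactor.shift [HasCoproducts.{v} K] {I : ObjectProperty K}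
    [I.IsStableUnderShift ℤ] {A : K} (hA : CompactMapsFactor I A) :
    CompactMapsFactor I (A⟦(1 : ℤ)⟧) := by
  intro X f hX
  obtain ⟨e, f', hf'⟩ := exists_comp_eq_map_shift f
  obtain ⟨E, g, h, hE, rfl⟩ := hA _ f' (compactObjects_shift hX (-1))
  exact ⟨E⟦(1 : ℤ)⟧, e.inv ≫ g⟦1⟧', h⟦1⟧', I.le_shift 1 _ hE, by
    rw [Category.assoc, ← Functor.map_comp, ← hf', Iso.inv_hom_id_assoc]⟩

end

section

variable {K : Type u} [Category.{v} K] [HasZeroObject K] [HasShift K ℤ] [Preadditive K]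
  [∀ n : ℤ, (shiftFunctor K n).Additive] [Pretriangulated K]

lemma biprod_mem {I : ObjectProperty K} [I.IsTriangulated] [I.IsClosedUnderIsomorphisms]
    {A B : K} (hA : I A) (hB : I B) : I (A ⊞ B) :=
  I.ext_of_isTriangulatedClosed₂ _ (binaryBiproductTriangle_distinguished A B) hA hB

lemma CompactMapsFactor.sigma [HasCoproducts.{v} K] {I : ObjectProperty K} [I.IsTriangulated]
    [I.IsClosedUnderIsomorphisms] {ι : Type v} {A : ι → K} (hA : ∀ i, I (A i)) :
    CompactMapsFactor I (∐ A) := by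
  intro X f hX
  revert f
  refine hX.sigma_induction ?_ ?_ fun i y => ⟨A i, y, Sigma.ι A i, hA i, rfl⟩
  · exact ⟨0, 0, 0, I.prop_zero, by simp⟩
  · rintro _ _ ⟨E₁, g₁, h₁, hE₁, rfl⟩ ⟨E₂, g₂, h₂, hE₂, rfl⟩
    exact ⟨E₁ ⊞ E₂, biprod.lift g₁ g₂, biprod.desc h₁ h₂, biprod_mem hE₁ hE₂, by simp⟩

/-- The cone `W` of `(n, k) : Z ⟶ F ⊞ X` is a homotopy pushout of `n` and `k`. It is an extension
of the cone `E` of `k : Z ⟶ X` by `F`, by the octahedral axiom. -/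
lemma homotopyPushout_mem [IsTriangulated K] {I : ObjectProperty K} [I.IsTriangulated]
    [I.IsClosedUnderIsomorphisms] {Z X E F W : K} {k : Z ⟶ X} {p : X ⟶ E} {δ : E ⟶ Z⟦(1 : ℤ)⟧}
    (hT : Triangle.mk k p δ ∈ distTriang K) (n : Z ⟶ F) {q : F ⊞ X ⟶ W} {ε : W ⟶ Z⟦(1 : ℤ)⟧}
    (hW : Triangle.mk (biprod.lift n k) q ε ∈ distTriang K) (hE : I E) (hF : I F) : I W := by
  have o := Triangulated.someOctahedron (u₁₂ := biprod.lift n k) (u₂₃ := biprod.snd)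
    (u₁₃ := k) (by simp) hW (rot_of_distTriang _ (binaryBiproductTriangle_distinguished F X)) hT
  exact I.ext_of_isTriangulatedClosed₁ _ o.mem hE (I.le_shift 1 _ hF)

/-- Given `f : X ⟶ T.obj₂` with `X` compact, the composite with `T.mor₂` factors through some
`E` in `I`. The restriction of `f` to the fibre `Z` of `X ⟶ E` comes from `T.obj₁`, hence factors
through some `F` in `I`. Therefore `f` factors through the homotopy pushout of `X` and `F`
over `Z`. -/
lemma CompactMapsFactor.ext₂ [HasCoproducts.{v} K] [IsTriangulated K] {I : ObjectProperty K}
    [I.IsTriangulated] [I.IsClosedUnderIsomorphisms] (hI : I ≤ compactObjects K)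
    {T : Triangle K} (hT : T ∈ distTriang K) (h₁ : CompactMapsFactor I T.obj₁)
    (h₃ : CompactMapsFactor I T.obj₃) : CompactMapsFactor I T.obj₂ := by
  intro X f hX
  obtain ⟨E, p, r, hE, hpr⟩ := h₃ X (f ≫ T.mor₂) hX
  obtain ⟨Z, k, δ, hZ⟩ := distinguished_cocone_triangle₁ p
  have hkp : k ≫ p = 0 := comp_distTriang_mor_zero₁₂ _ hZ
  have hZc : compactObjects K Z :=
    (compactObjects K).ext_of_isTriangulatedClosed₁ _ hZ hX (hI _ hE)
  obtain ⟨l, hl⟩ := Triangle.coyoneda_exact₂ T hT (k ≫ f) (by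
    rw [Category.assoc, hpr, reassoc_of% hkp, zero_comp])
  obtain ⟨F, n, m, hF, rfl⟩ := h₁ Z l hZc
  obtain ⟨W, q, ε, hW⟩ := distinguished_cocone_triangle (biprod.lift n k)
  obtain ⟨w : W ⟶ _, hw : _ = q ≫ w⟩ := Triangle.yoneda_exact₂ _ hW
    (biprod.desc (-(m ≫ T.mor₁)) f) (by
      change biprod.lift n k ≫ biprod.desc _ f = 0
      rw [biprod.lift_desc, hl]
      simp)
  refine ⟨W, biprod.inr ≫ q, w, homotopyPushout_mem hZ n hW hE hF, ?_⟩
  rw [Category.assoc, ← hw, biprod.inr_desc]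

end

/-! ### Localization with respect to a class of compact objects -/

/-- For a small class `Q`, all maps `t` from objects of `Q` to `X` that satisfy a condition `p`
can be combined into a single map from a coproduct of objects of `Q`. -/
lemma exists_sigma_map {K : Type u} [Category.{v} K] [HasCoproducts.{v} K]
    (Q : ObjectProperty K) [ObjectProperty.Small.{v} Q] {X : K}
    (p : ∀ C : K, (C ⟶ X) → Prop) :
    ∃ (ι : Type v) (A : ι → K) (t : ∐ A ⟶ X), (∀ i, Q (A i)) ∧ (∀ i, p _ (Sigma.ι A i ≫ t)) ∧
      ∀ (C : K) (y : C ⟶ X), Q C → p C y → ∃ z : C ⟶ ∐ A, y = z ≫ t := by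
  let B : Shrink.{v} (Subtype Q) → K := fun j => ((equivShrink _).symm j).1
  let A : (Σ j : Shrink.{v} (Subtype Q), {y : B j ⟶ X // p _ y}) → K := fun i => B i.1
  refine ⟨_, A, Sigma.desc fun i => i.2.1, fun i => ((equivShrink _).symm i.1).2, fun i => ?_,
    fun C y hC hy => ?_⟩
  · rw [Sigma.ι_desc]
    exact i.2.2
  · obtain ⟨j, hj⟩ : ∃ j, B j = C :=
      ⟨equivShrink _ ⟨C, hC⟩, by simp [B]⟩
    subst hj
    refine ⟨Sigma.ι A ⟨j, y, hy⟩, ?_⟩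
    rw [Sigma.ι_desc]

/-- A coproduct of objects of `I` over `N` through which all maps from objects of `I` to `N`
factor. -/
lemma exists_over_surjective {K : Type u} [Category.{v} K] [HasCoproducts.{v} K]
    {I : ObjectProperty K} [ObjectProperty.EssentiallySmall.{v} I] (N : K) :
    ∃ (ι : Type v) (A : ι → K) (f : ∐ A ⟶ N), (∀ i, I (A i)) ∧
      ∀ (C : K) (y : C ⟶ N), I C → ∃ z : C ⟶ ∐ A, y = z ≫ f := by
  obtain ⟨Q, _, hQI, hIQ⟩ := ObjectProperty.EssentiallySmall.exists_small_le.{v} I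
  obtain ⟨ι, A, f, hA, -, h⟩ := exists_sigma_map (X := N) Q (fun _ _ => True)
  refine ⟨ι, A, f, fun i => hQI _ (hA i), fun C y hC => ?_⟩
  obtain ⟨C', hC', ⟨e⟩⟩ := hIQ _ hC
  obtain ⟨z, hz⟩ := h C' (e.inv ≫ y) hC' trivial
  exact ⟨e.hom ≫ z, by rw [Category.assoc, ← hz, Iso.hom_inv_id_assoc]⟩

section

variable {K : Type u} [Category.{v} K] [HasZeroObject K] [HasShift K ℤ] [Preadditive K]
  [∀ n : ℤ, (shiftFunctor K n).Additive] [Pretriangulated K] [HasCoproducts.{v} K]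

/-- One step in the construction of the localization triangle of `N`: the maps from objects of
`I` to `X` that vanish in `N` are killed by attaching cones. -/
lemma exists_attach_cones {I : ObjectProperty K} [ObjectProperty.EssentiallySmall.{v} I] {N : K}
    (X : Over N) : ∃ (Y : Over N) (t : X ⟶ Y),
      (∀ (C : K) (y : C ⟶ X.left), I C → y ≫ X.hom = 0 → y ≫ t.left = 0) ∧
      ∃ (ι : Type v) (A : ι → K) (r : ∐ A ⟶ X.left) (q : Y.left ⟶ (∐ A)⟦(1 : ℤ)⟧),
        (∀ i, I (A i)) ∧ Triangle.mk r t.left q ∈ distTriang K := by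
  obtain ⟨Q, _, hQI, hIQ⟩ := ObjectProperty.EssentiallySmall.exists_small_le.{v} I
  obtain ⟨ι, A, r, hA, hr, h⟩ := exists_sigma_map Q (fun C (y : C ⟶ X.left) => y ≫ X.hom = 0)
  have hr' : r ≫ X.hom = 0 := Sigma.hom_ext _ _ fun i => by
    rw [← Category.assoc, hr, comp_zero]
  obtain ⟨Y, t, q, hT⟩ := distinguished_cocone_triangle r
  obtain ⟨f : Y ⟶ N, hf : X.hom = t ≫ f⟩ := Triangle.yoneda_exact₂ _ hT X.hom hr'
  refine ⟨Over.mk f, Over.homMk t hf.symm, fun C y hC hy => ?_, ι, A, r, q,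
    fun i => hQI _ (hA i), hT⟩
  obtain ⟨C', hC', ⟨e⟩⟩ := hIQ _ hC
  obtain ⟨z, hz⟩ := h C' (e.inv ≫ y) hC' (by rw [Category.assoc, hy, comp_zero])
  have hrt : r ≫ t = 0 := comp_distTriang_mor_zero₁₂ _ hT
  change y ≫ t = 0
  rw [← cancel_epi e.inv, ← Category.assoc, hz, Category.assoc, hrt, comp_zero,
    comp_zero]

/-- The localization `L` of `N` with respect to `I` exists, and if it vanishes for a compact
object `N`, then `N` belongs to `I`. The object `Γ` is the homotopy colimit of a sequence of
objects over `N`: the first term is a coproduct of objects of `I` on which all maps from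
objects of `I` to `N` are visible, and each step kills the maps from objects of `I` that vanish in
`N`. All terms are finite extensions of coproducts of objects of `I`, so that maps from compact
objects to them factor through `I`; for `Γ ≅ N` this exhibits `N` as a retract of
an object of `I`. -/
theorem exists_isLocalizationObj [IsTriangulated K] {I : ObjectProperty K} [I.IsTriangulated]
    [I.IsStableUnderRetracts] [ObjectProperty.EssentiallySmall.{v} I]
    (hI : I ≤ compactObjects K) (N : K) :
    ∃ L : K, IsLocalizationObj I N L ∧ (IsZero L → compactObjects K N → I N) := by
  obtain ⟨ι₀, A₀, f₀, hA₀, hf₀⟩ := exists_over_surjective (I := I) N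
  choose next t ht ι A r q hA hT using fun X : Over N => exists_attach_cones (I := I) X
  let G : ℕ → Over N := fun n => Nat.rec (Over.mk f₀) (fun _ X => next X) n
  obtain ⟨Γ, a, ha, hcomp, hdesc, hloc⟩ := exists_homotopyColimit
    (A := fun n => (G n).left) (fun n => (t (G n)).left)
  obtain ⟨f, hf⟩ := hdesc N (fun n => (G n).hom) fun n => Over.w (t (G n))
  obtain ⟨L, g, h, hL⟩ := distinguished_cocone_triangle f
  have hsurj : ∀ (C : K) (y : C ⟶ N), I C → ∃ z : C ⟶ Γ, y = z ≫ f := fun C y hC => by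
    obtain ⟨z, hz⟩ := hf₀ C y hC
    exact ⟨z ≫ a 0, by rw [Category.assoc, hf, hz]; rfl⟩
  have hinj : ∀ (C : K) (y : C ⟶ Γ), I C → y ≫ f = 0 → y = 0 := fun C y hC hy => by
    obtain ⟨n, y, rfl⟩ := hcomp C (hI _ hC) y
    rw [Category.assoc, hf] at hy
    rw [← ha, ← Category.assoc, ht (G n) C y hC hy, zero_comp]
  -- The next term is an extension of the shift of a coproduct of objects of `I` by `G n`.
  have hG : ∀ n, CompactMapsFactor I (G n).left := by
    intro n
    induction n with
    | zero => exact CompactMapsFactor.sigma hA₀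
    | succ n ih =>
      exact CompactMapsFactor.ext₂ hI (rot_of_distTriang _ (hT (G n))) ih
        (CompactMapsFactor.sigma (hA (G n))).shift
  refine ⟨L, ⟨⟨Γ, f, g, h, hL, fun P hP hIP => hloc P hP fun n => ?_⟩, fun C φ hC => ?_⟩,
    fun hLz hN => ?_⟩
  · induction n with
    | zero => exact hP.sigma fun i => hIP _ (hA₀ i)
    | succ n ih => exact hP.cone (hT (G n)) (hP.sigma fun i => hIP _ (hA (G n) i)) ih
  · have hhf : h ≫ f⟦(1 : ℤ)⟧' = 0 := comp_distTriang_mor_zero₃₁ _ hL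
    have hfg : f ≫ g = 0 := comp_distTriang_mor_zero₁₂ _ hL
    have hφ : φ ≫ h = 0 := eq_zero_of_comp_shift_eq_zero hinj hC _ (by
      rw [Category.assoc, hhf, comp_zero])
    obtain ⟨y : C ⟶ N, rfl : φ = y ≫ g⟩ := Triangle.coyoneda_exact₃ _ hL φ hφ
    obtain ⟨z, rfl⟩ := hsurj C y hC
    rw [Category.assoc, hfg, comp_zero]
  · have : IsIso f := (Triangle.isZero₃_iff_isIso₁ _ hL).1 hLz
    obtain ⟨n, y, hy⟩ := hcomp N hN (inv f)
    obtain ⟨E, i, p, hE, rfl⟩ := hG n N y hN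
    refine I.prop_of_retract ⟨i, p ≫ a n ≫ f, ?_⟩ hE
    rw [← Category.assoc, ← Category.assoc, ← hy, IsIso.inv_hom_id]

end

/-! ### Thick right ideals and supports -/

section

variable {K : Type u} [Category.{v} K] [HasZeroObject K] [HasShift K ℤ] [Preadditive K]
  [∀ n : ℤ, (shiftFunctor K n).Additive] [Pretriangulated K] [MonoidalCategory K]

lemma isThickRightIdeal_compactObjects (hK : IsCompactlyGeneratedMonoidal K) :
    IsThickRightIdeal (compactObjects K) :=
  have := hK.coproducts
  { le_compact := le_rfl
    triangulated := inferInstance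
    retracts := inferInstance
    tensor := hK.compact_tensor }

lemma mem_rightIdeal_self (M : K) : rightIdeal M M := fun _ _ h => h

lemma rightIdeal_le {I : ObjectProperty K} (hI : IsThickRightIdeal I) {M : K} (hM : I M) :
    rightIdeal M ≤ I := fun _ hA => hA I hI hM

lemma isThickRightIdeal_rightIdeal (hK : IsCompactlyGeneratedMonoidal K) {M : K}
    (hM : compactObjects K M) : IsThickRightIdeal (rightIdeal M) where
  le_compact := rightIdeal_le (isThickRightIdeal_compactObjects hK) hM
  triangulated :=
    { exists_zero := ⟨0, isZero_zero K, fun I hI _ =>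
        have := hI.triangulated
        have := hI.retracts
        I.prop_zero⟩
      isStableUnderShiftBy := fun n => ⟨fun _ hA I hI hM =>
        have := hI.triangulated
        I.le_shift n _ (hA I hI hM)⟩
      ext₂' := fun T hT h₁ h₃ => ObjectProperty.le_isoClosure _ _ fun I hI hM =>
        have := hI.triangulated
        have := hI.retracts
        I.ext_of_isTriangulatedClosed₂ T hT (h₁ I hI hM) (h₃ I hI hM) }
  retracts := ⟨fun r hA I hI hM =>
    have := hI.retracts
    I.prop_of_retract r (hA I hI hM)⟩
  tensor A B hA hB := fun I hI hM => hI.tensor A B (hA I hI hM) hB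

variable {X : Type w} {σ : K → Set X}

lemma support_eq_of_iso (hσ : IsExtendedSupport σ) {A B : K} (e : A ≅ B) : σ A = σ B := by
  have hc : IsColimit (Cofan.mk (f := fun _ : PUnit.{v + 1} => B) A fun _ => e.inv) :=
    Cofan.IsColimit.mk _ (fun s => e.hom ≫ s.inj PUnit.unit) (by simp)
      (fun s m hm => by simp [← hm PUnit.unit])
  exact (hσ.coproduct _ _ _ ⟨hc⟩).trans (Set.iUnion_const _)

lemma support_shift (hσ : IsExtendedSupport σ) (A : K) (n : ℤ) : σ (A⟦n⟧) = σ A := by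
  have h : ∀ n : ℤ, σ (A⟦n + 1⟧) = σ (A⟦n⟧) := fun n => by
    rw [support_eq_of_iso hσ ((shiftFunctorAdd K n 1).app A)]
    exact hσ.shift _
  induction n using Int.induction_on with
  | zero => exact support_eq_of_iso hσ ((shiftFunctorZero K ℤ).app A)
  | succ n ih => rw [h, ih]
  | pred n ih => rw [← h, sub_add_cancel, ih]

/-- The complement of a retract is again compact, so additivity of the support on compact objects
applies. -/
lemma support_subset_of_retract [HasCoproducts.{v} K] (hσ : IsExtendedSupport σ)
    (hσc : IsQuasiSupportOnCompacts σ) {A B : K} (r : Retract A B) (hB : compactObjects K B) :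
    σ A ⊆ σ B := by
  have hA := compactObjects_of_retract r hB
  obtain ⟨C, g, h, hT⟩ := distinguished_cocone_triangle r.i
  have hC : compactObjects K C := (compactObjects K).ext_of_isTriangulatedClosed₃ _ hT hA hB
  have hh : h = 0 := Triangle.mor₃_eq_zero_of_mono₁ _ hT (inferInstanceAs (Mono r.i))
  obtain ⟨e, -⟩ := exists_iso_binaryBiproduct_of_distTriang _ hT hh
  exact Set.subset_union_left.trans
    ((hσc.sum _ _ hA hC).symm.trans (support_eq_of_iso hσ e).symm).subset

/-- The compact objects supported in a given set form a thick right ideal. -/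
lemma isThickRightIdeal_support_subset (hK : IsCompactlyGeneratedMonoidal K)
    (hσ : IsExtendedSupport σ) (hσc : IsQuasiSupportOnCompacts σ) (W : Set X) :
    IsThickRightIdeal fun A : K => compactObjects K A ∧ σ A ⊆ W := by
  have := hK.coproducts
  refine ⟨fun _ h => h.1, { exists_zero := ?_, isStableUnderShiftBy := ?_, ext₂' := ?_ },
    ⟨fun r h => ?_⟩, fun A B hA hB => ?_⟩
  · exact ⟨0, isZero_zero K, compactObjects_of_isZero (isZero_zero K), by simp [hσ.zero]⟩
  · exact fun n => ⟨fun A hA => ⟨compactObjects_shift hA.1 n, by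
      rw [support_shift hσ]; exact hA.2⟩⟩
  · refine fun T hT h₁ h₃ => ObjectProperty.le_isoClosure _ _
      ⟨compactObjects_ext₂ hT h₁.1 h₃.1, ?_⟩
    refine (hσ.triangle _ (rot_of_distTriang _ hT)).trans (Set.union_subset h₃.2 ?_)
    exact (support_shift hσ T.obj₁ 1).trans_subset h₁.2
  · exact ⟨compactObjects_of_retract r h.1,
      (support_subset_of_retract hσ hσc r h.1).trans h.2⟩
  · exact ⟨hK.compact_tensor A B hA.1 hB, (hσc.tensor A B hA.1 hB).trans hA.2⟩

/-- Since the tensor product shrinks the support of its left factor, passing to the generated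
right ideal does not enlarge the support. -/
lemma Phi_rightIdeal (hK : IsCompactlyGeneratedMonoidal K) (hσ : IsExtendedSupport σ)
    (hσc : IsQuasiSupportOnCompacts σ) {M : K} (hM : compactObjects K M) :
    Phi σ (rightIdeal M) = σ M := by
  refine Set.Subset.antisymm (Set.iUnion₂_subset fun A hA => ?_)
    (Set.subset_biUnion_of_mem (u := σ) (mem_rightIdeal_self M))
  exact (hA _ (isThickRightIdeal_support_subset hK hσ hσc (σ M)) ⟨hM, subset_rfl⟩).2

lemma Theta_iff (hK : IsCompactlyGeneratedMonoidal K) (hσ : IsExtendedSupport σ)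
    (hσc : IsQuasiSupportOnCompacts σ) (W : Set X) (M : K) :
    Theta σ W M ↔ compactObjects K M ∧ σ M ⊆ W :=
  and_congr_right fun hM => by rw [Phi_rightIdeal hK hσ hσc hM]

lemma isThickRightIdeal_Theta (hK : IsCompactlyGeneratedMonoidal K) (hσ : IsExtendedSupport σ)
    (hσc : IsQuasiSupportOnCompacts σ) (W : Set X) : IsThickRightIdeal (Theta σ W) := by
  rw [show Theta σ W = _ from funext fun M => propext (Theta_iff hK hσ hσc W M)]
  exact isThickRightIdeal_support_subset hK hσ hσc W

/-- If `L` receives no non-zero map from the right ideal generated by `M`, then the dual `D` of `M`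
annihilates `L`: a map `Q ⟶ D ⊗ L` with `Q` compact corresponds to a map `M ⊗ Q ⟶ L`. -/
lemma isZero_dual_tensor (hK : IsCompactlyGeneratedMonoidal K) {M D L : K} [ExactPairing D M]
    (hM : compactObjects K M) (hL : ∀ (C : K) (φ : C ⟶ L), rightIdeal M C → φ = 0) :
    IsZero (D ⊗ L) := by
  by_contra h
  obtain ⟨Q, f, hQ, hf⟩ := hK.generates _ h
  have hMQ : rightIdeal M (M ⊗ Q) :=
    (isThickRightIdeal_rightIdeal hK hM).tensor _ _ (mem_rightIdeal_self M) hQ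
  refine hf ((tensorLeftHomEquiv Q D M L).symm.injective ?_)
  rw [hL _ ((tensorLeftHomEquiv Q D M L).symm f) hMQ,
    hL _ ((tensorLeftHomEquiv Q D M L).symm 0) hMQ]

/-- A closed subset of the support of `I` has finitely many irreducible components, and it lies in
the support of the sum of objects of `I` whose supports contain their generic points. -/
lemma exists_mem_support_superset [TopologicalSpace X] [NoetherianSpace X]
    [QuasiSober X] (hσc : IsQuasiSupportOnCompacts σ) {I : ObjectProperty K}
    (hI : IsThickRightIdeal I) (hclosed : ∀ C : K, compactObjects K C → IsClosed (σ C))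
    {Z : Set X} (hZ : IsClosed Z)
    (hZI : Z ⊆ Phi σ I) : ∃ C : K, I C ∧ Z ⊆ σ C := by
  have := hI.triangulated
  have := hI.retracts
  obtain ⟨S, hS, hSc, hSi, rfl⟩ := NoetherianSpace.exists_finite_set_isClosed_irreducible hZ
  clear hZ
  induction S, hS using Set.Finite.induction_on with
  | empty => exact ⟨0, I.prop_zero, by simp⟩
  | @insert T S _ _ ih =>
    rw [Set.sUnion_insert] at hZI ⊢
    obtain ⟨C, hC, hSC⟩ := ih
      (fun t ht => hSc t (Set.mem_insert_of_mem _ ht))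
      (fun t ht => hSi t (Set.mem_insert_of_mem _ ht)) (Set.subset_union_right.trans hZI)
    obtain ⟨x, hx⟩ := QuasiSober.sober (hSi T (Set.mem_insert _ _)) (hSc T (Set.mem_insert _ _))
    obtain ⟨E, hE, hxE⟩ := Set.mem_iUnion₂.1 (hZI (Or.inl hx.mem))
    refine ⟨E ⊞ C, biprod_mem hE hC, ?_⟩
    rw [hσc.sum _ _ (hI.le_compact _ hE) (hI.le_compact _ hC)]
    exact Set.union_subset_union
      ((hx.mem_closed_set_iff (hclosed E (hI.le_compact _ hE))).1 hxE) hSC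

variable [IsTriangulated K]

/-- The supports of compact objects detect the inclusion of principal right ideals. -/
lemma mem_rightIdeal_of_support_subset (hK : IsCompactlyGeneratedMonoidal K)
    (hσ : IsExtendedSupport σ) (hσc : IsQuasiSupportOnCompacts σ) (hA : HomologicalAssumption σ)
    {M N : K} (hM : compactObjects K M) (hN : compactObjects K N) (h : σ N ⊆ σ M) :
    rightIdeal M N := by
  have := hK.coproducts
  have hI := isThickRightIdeal_rightIdeal hK hM
  have := hI.triangulated
  have := hI.retracts
  have := hK.small
  have := ObjectProperty.EssentiallySmall.of_le.{v} hI.le_compact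
  obtain ⟨L, hL, hLN⟩ := exists_isLocalizationObj hI.le_compact N
  obtain ⟨D, ⟨_⟩⟩ := (hK.rigid M hM).2
  exact hLN (hA M N hM hN (by rwa [Phi_rightIdeal hK hσ hσc hN]) D L ⟨inferInstance⟩ hL
    (isZero_dual_tensor hK hM hL.2)) hN

lemma Theta_Phi_rightIdeal (hK : IsCompactlyGeneratedMonoidal K)
    (hσ : IsExtendedSupport σ) (hσc : IsQuasiSupportOnCompacts σ) (hA : HomologicalAssumption σ)
    {M : K} (hM : compactObjects K M) : Theta σ (Phi σ (rightIdeal M)) = rightIdeal M := by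
  ext N
  rw [Theta_iff hK hσ hσc]
  refine ⟨fun h => mem_rightIdeal_of_support_subset hK hσ hσc hA hM h.1 ?_, fun h => ?_⟩
  · rw [← Phi_rightIdeal hK hσ hσc hM]
    exact h.2
  · exact ⟨(isThickRightIdeal_rightIdeal hK hM).le_compact _ h,
      Set.subset_biUnion_of_mem (u := σ) h⟩

lemma Theta_Phi [TopologicalSpace X] [NoetherianSpace X] [QuasiSober X]
    (hK : IsCompactlyGeneratedMonoidal K) (hσ : IsExtendedSupport σ)
    (hσc : IsQuasiSupportOnCompacts σ) (hA : HomologicalAssumption σ)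
    (hclosed : ∀ C : K, compactObjects K C → IsClosed (σ C)) {I : ObjectProperty K}
    (hI : IsThickRightIdeal I) : Theta σ (Phi σ I) = I := by
  ext N
  rw [Theta_iff hK hσ hσc]
  refine ⟨fun h => ?_, fun h => ⟨hI.le_compact _ h, Set.subset_biUnion_of_mem (u := σ) h⟩⟩
  obtain ⟨C, hC, hNC⟩ := exists_mem_support_superset hσc hI hclosed (hclosed N h.1) h.2
  exact rightIdeal_le hI hC _ (mem_rightIdeal_of_support_subset hK hσ hσc hA
    (hI.le_compact _ hC) h.1 hNC)

end

end MonoidalTriangulated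

/-! ### The bijection with specialization-closed subsets -/

theorem theoremD {K : Type u} [Category.{v} K] [HasZeroObject K] [HasShift K ℤ] [Preadditive K]
    [∀ n : ℤ, (shiftFunctor K n).Additive] [Pretriangulated K] [IsTriangulated K]
    [MonoidalCategory K] (hK : MonoidalTriangulated.IsCompactlyGeneratedMonoidal K)
    {X : Type w} [TopologicalSpace X] [NoetherianSpace X] [QuasiSober X] [T0Space X]
    (σ : K → Set X)
    (hσ : MonoidalTriangulated.IsExtendedSupport σ)
    (hσc : MonoidalTriangulated.IsQuasiSupportOnCompacts σ)
    (hA : MonoidalTriangulated.HomologicalAssumption σ) :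
    (∀ M : K, MonoidalTriangulated.compactObjects K M →
      MonoidalTriangulated.Theta σ
        (MonoidalTriangulated.Phi σ (MonoidalTriangulated.rightIdeal M)) =
          MonoidalTriangulated.rightIdeal M) ∧
    ((∀ C : K, MonoidalTriangulated.compactObjects K C →
        IsClosed (MonoidalTriangulated.Phi σ (MonoidalTriangulated.rightIdeal C))) →
      MonoidalTriangulated.Realization σ →
      (∀ I : ObjectProperty K, MonoidalTriangulated.IsThickRightIdeal I →
        StableUnderSpecialization (MonoidalTriangulated.Phi σ I)) ∧
      (∀ W : Set X, StableUnderSpecialization W →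
        MonoidalTriangulated.IsThickRightIdeal (MonoidalTriangulated.Theta σ W)) ∧
      (∀ I : ObjectProperty K, MonoidalTriangulated.IsThickRightIdeal I →
        MonoidalTriangulated.Theta σ (MonoidalTriangulated.Phi σ I) = I) ∧
      (∀ W : Set X, StableUnderSpecialization W →
        MonoidalTriangulated.Phi σ (MonoidalTriangulated.Theta σ W) = W)) := by
  refine ⟨fun M hM => MonoidalTriangulated.Theta_Phi_rightIdeal hK hσ hσc hA hM,
    fun hclosed hreal => ?_⟩
  have hΦ : ∀ C : K, MonoidalTriangulated.compactObjects K C →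
      MonoidalTriangulated.Phi σ (MonoidalTriangulated.rightIdeal C) = σ C :=
    fun C hC => MonoidalTriangulated.Phi_rightIdeal hK hσ hσc hC
  have hclosed' : ∀ C : K, MonoidalTriangulated.compactObjects K C → IsClosed (σ C) :=
    fun C hC => hΦ C hC ▸ hclosed C hC
  refine ⟨fun I hI x y hxy hx => ?_,
    fun W _ => MonoidalTriangulated.isThickRightIdeal_Theta hK hσ hσc W,
    fun I hI => MonoidalTriangulated.Theta_Phi hK hσ hσc hA hclosed' hI, fun W hW => ?_⟩
  · obtain ⟨C, hC, hxC⟩ := Set.mem_iUnion₂.1 hx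
    exact Set.mem_iUnion₂.2 ⟨C, hC, hxy.mem_closed (hclosed' C (hI.le_compact _ hC)) hxC⟩
  · refine Set.Subset.antisymm (Set.iUnion₂_subset fun A hA' =>
      ((MonoidalTriangulated.Theta_iff hK hσ hσc W A).1 hA').2) fun x hx => ?_
    obtain ⟨M, hM, hMx⟩ := hreal (closure {x}) isClosed_closure
    refine Set.mem_iUnion₂.2 ⟨M, ⟨hM, ?_⟩, ?_⟩
    · rw [hMx]
      exact fun y hy => hW (specializes_iff_mem_closure.2 hy) hx
    · rw [← hΦ M hM, hMx]
      exact subset_closure rfl
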